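/- Let $\mathcal E$ be a locally finite subset of $[0,+\infty[$ and let $\omega:\mathcal E\to\,]0,+\infty[$ be a weight function. Put $\mathcal N_{\mathcal E,\omega}(t)=\sum_{x\in\mathcal E\cap[0,t]}\omega(x)$ for $t\ge 0$. Assume that there exist $\alpha\in\mathbb R$, $c,\delta>0$ and $\kappa\ge 0$ such that, as $t\to+\infty$, $$\mathcal N_{\mathcal E,\omega}(t)=c\,t^{\alpha}e^{\delta t}\bigl(1+o(e^{-\kappa t})\bigr).$$ Let $\psi:\mathbb N\to[1,+\infty[$ be at most polynomially growing, that is, $\lim_{N\to+\infty}\psi(N)/N^{\gamma}=0$ for some $\gamma>0$. Put $F_N=\{x\in\mathcal E: x\le N\}$ and $$\psi'(N)=\frac{\mathcal N_{\mathcal E,\omega}(N)^2}{\psi(N)},\qquad \mathcal R_N=\sum_{x,y\in F_N}\omega(x)\,\omega(y)\,\Delta_{\psi(N)(y-x)},$$ where $\Delta_z$ is the unit Dirac mass at $z\in\mathbb R$ (note that $\psi'(N)>0$ for $N$ large enough). Then, for the weak-star convergence of measures on $\mathbb R$ (tested on continuous functions with compact support): 1. If $\psi(N)=1$ for all $N$,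 then $\frac{1}{\psi'(N)}\mathcal R_N$ converges to $\frac{\delta}{2}e^{-\delta|t|}\,dt$ as $N\to+\infty$. That is, the family $\mathcal F=((F_N)_{N\in\mathbb N},\omega)$ has the pair correlation function $t\mapsto\frac{\delta}{2}e^{-\delta|t|}$ for the scaling $\psi=1$ and renormalisation $\psi'$. 2. If $\lim_{N\to+\infty}\psi(N)=+\infty$ and $\kappa>0$, then $\frac{1}{\psi'(N)}\mathcal R_N$ converges to $\frac{\delta}{2}\,dt$ as $N\to+\infty$. That is, $\mathcal F$ has Poissonian behaviour for the scaling $\psi$ and renormalisation $\psi'$, with constant pair correlation function $\frac{\delta}{2}$. -/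

import Mathlib

open Filter Topology MeasureTheory Asymptotics

noncomputable section

/-- A subset of the real line is locally finite if it has finitely many points in each compact
set. -/
def IsLocallyFiniteSet (E : Set ℝ) : Prop :=
  ∀ K : Set ℝ, IsCompact K → (E ∩ K).Finite

/-- `ω` is a weight function on `E`: it takes positive values on `E` (its values off `E` are
never used). -/
def IsWeightOn (E : Set ℝ) (ω : ℝ → ℝ) : Prop :=
  ∀ x ∈ E, 0 < ω x

/-- The growth function `t ↦ ∑_{x ∈ E ∩ [0, t]} ω x` of a locally finite set `E` (the sum is
finite when `E` is locally finite). -/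
def growthFunction (E : Set ℝ) (ω : ℝ → ℝ) (t : ℝ) : ℝ :=
  ∑ᶠ x ∈ E ∩ Set.Icc 0 t, ω x

/-- A nondecreasing sequence `(F_N)` of finite subsets of the real line, with a positive weight on
its union. -/
structure WeightedFamily where
  sets : ℕ → Finset ℝ
  mono : Monotone sets
  weight : ℝ → ℝ
  weight_pos : ∀ N, ∀ x ∈ sets N, 0 < weight x

/-- The pair correlation measure of the family at time `N` with scaling `ψ N`:
the sum over `x, y ∈ F_N` of the masses `ω x * ω y` at the points `ψ N * (y - x)`. -/
def pairCorrelationMeasure (F : WeightedFamily) (ψ : ℕ → ℝ) (N : ℕ) : Measure ℝ :=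
  ∑ x ∈ F.sets N, ∑ y ∈ F.sets N,
    ENNReal.ofReal (F.weight x * F.weight y) • Measure.dirac (ψ N * (y - x))

/-- Weak-star convergence of a sequence of (locally finite) measures, tested on
continuous functions with compact support. -/
def WeakStarTendsto (μ : ℕ → Measure ℝ) (ν : Measure ℝ) : Prop :=
  ∀ f : ℝ → ℝ, Continuous f → HasCompactSupport f →
    Tendsto (fun N => ∫ t, f t ∂(μ N)) atTop (𝓝 (∫ t, f t ∂ν))

/-- `g` is the asymptotic pair correlation function of `F` for the scaling `ψ` and the
renormalisation `ψ'`: it is nonnegative and locally integrable, and the pair correlation measures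
divided by `ψ' N` converge weak-star to the measure with density `g` with respect to the Lebesgue
measure. -/
structure HasPairCorrelationFunction (F : WeightedFamily) (ψ ψ' : ℕ → ℝ) (g : ℝ → ℝ) : Prop where
  nonneg : ∀ t, 0 ≤ g t
  locallyIntegrable : LocallyIntegrable g volume
  tendsto : WeakStarTendsto
    (fun N => ENNReal.ofReal (1 / ψ' N) • pairCorrelationMeasure F ψ N)
    (volume.withDensity fun t => ENNReal.ofReal (g t))

/-- Poissonian behaviour: the pair correlation function exists and is a positive constant `a`. -/
def HasPoissonianBehaviour (F : WeightedFamily) (ψ ψ' : ℕ → ℝ) (a : ℝ) : Prop :=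
  0 < a ∧ HasPairCorrelationFunction F ψ ψ' (fun _ => a)

/-- A sequence is at most polynomially growing if it is negligible with respect to some positive
power of `n`. -/
def AtMostPolynomiallyGrowing (x : ℕ → ℝ) : Prop :=
  ∃ γ : ℝ, 0 < γ ∧ Tendsto (fun n : ℕ => x n / (n : ℝ) ^ γ) atTop (𝓝 0)

theorem IsLocallyFiniteSet.finite_le {E : Set ℝ} (hE : IsLocallyFiniteSet E)
    (hE0 : E ⊆ Set.Ici 0) (N : ℕ) : {x ∈ E | x ≤ (N : ℝ)}.Finite :=
  (hE (Set.Icc 0 (N : ℝ)) isCompact_Icc).subset fun _ hx => ⟨hx.1, hE0 hx.1, hx.2⟩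

/-- The family `F_N = {x ∈ E : x ≤ N}` with the weight `ω`, for a locally finite subset `E` of
`[0, +∞[`. -/
def truncationFamily (E : Set ℝ) (hE0 : E ⊆ Set.Ici 0) (hE : IsLocallyFiniteSet E)
    (ω : ℝ → ℝ) (hω : IsWeightOn E ω) : WeightedFamily where
  sets N := (hE.finite_le hE0 N).toFinset
  mono := fun _ _ hMN x hx => by
    rw [Set.Finite.mem_toFinset] at hx ⊢
    exact ⟨hx.1, hx.2.trans (by exact_mod_cast hMN)⟩
  weight := ω
  weight_pos := fun _ x hx => hω x ((Set.Finite.mem_toFinset _).1 hx).1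

/-- The renormalising function `ψ' N = (∑_{x ∈ E ∩ [0, N]} ω x) ^ 2 / ψ N`. -/
def renormalisingFunction (E : Set ℝ) (ω : ℝ → ℝ) (ψ : ℕ → ℝ) (N : ℕ) : ℝ :=
  growthFunction E ω N ^ 2 / ψ N

end

/-!
Let `S` be the distance `N - x` from the endpoint `N` to a point `x` of `F_N` drawn with probability
proportional to its weight, and let `G` be the growth function. The tail of `S` is
`P(S ≥ u) = G (N - u) / G N`, which tends to `e ^ {-δ u}` (`tendsto_ratio_of_equiv`): gaps are
asymptotically exponential of rate `δ`. As `y - x` is the difference of the gaps of `x` and `y`, the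
rescaled pair correlation measure is `ψ N` times the law of `ψ N * (S' - S)`, where `S` and `S'` are
independent gaps. It gives an interval `[a, b[` the mass `E(φ N S)`, where
`φ N s = ψ N * P(S' ∈ [s + a / ψ N, s + b / ψ N[)` (`gapCorrelation`,
`pairCorrelationMeasure_real_Ico`), and it suffices to find the limits of these masses
(`weakStarTendsto_of_Ico`).

* If `ψ = 1`, then `φ N s` tends to `P(S' ∈ [s + a, s + b[)` for an exponential variable `S'`, and
  the limit is the law of the difference of two independent exponential variables, which has the
  Laplace density `δ / 2 * e ^ {-δ |t|}` (`integral_expMeasure_expTail`).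
* If `ψ` tends to infinity, then `φ N s` tends to `(b - a) δ e ^ {-δ s}`, by the mean value theorem
  applied to `c t ^ α e ^ {δ t}`; the error term `e ^ {-κ t}` of `G` is what beats the factor `ψ N`,
  which grows at most polynomially (`tendsto_gapCorrelation_of_tendsto_atTop`). Then
  `E(φ N S)` tends to `(b - a) δ E(e ^ {-δ S}) = (b - a) δ / 2`.

Both limits of `φ N` are locally uniform in `s > 0`, and `φ N` is bounded uniformly in `s` and in
large `N` (`abs_gapCorrelation_le_one`, `eventually_abs_gapCorrelation_le`), so the expectations converge
(`tendsto_integral_of_tendstoUniformlyOn`).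
-/

/-! ### Convergence of measures tested on half-open intervals -/

/-- The error of a left Riemann–Stieltjes sum with `n` steps of length `h`. -/
theorem abs_setIntegral_Ico_sub_sum_le {μ : Measure ℝ} [IsLocallyFiniteMeasure μ] {f : ℝ → ℝ}
    (hf : Continuous f) {a h ε : ℝ} (hh : 0 ≤ h) (n : ℕ)
    (hosc : ∀ x ∈ Set.Icc a (a + n * h), ∀ y ∈ Set.Icc a (a + n * h),
      |x - y| ≤ h → |f x - f y| ≤ ε) :
    |∫ x in Set.Ico a (a + n * h), f x ∂μ -
        ∑ i ∈ Finset.range n, f (a + i * h) * μ.real (Set.Ico (a + i * h) (a + (i + 1 : ℕ) * h))|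
      ≤ ε * μ.real (Set.Ico a (a + n * h)) := by
  induction n with
  | zero => simp
  | succ n ih =>
    have hint : ∀ u v : ℝ, IntegrableOn f (Set.Ico u v) μ := fun u v =>
      (hf.continuousOn.integrableOn_Icc).mono_set Set.Ico_subset_Icc_self
    have hfin : ∀ u v : ℝ, μ (Set.Ico u v) ≠ ⊤ := fun u v =>
      (lt_of_le_of_lt (measure_mono Set.Ico_subset_Icc_self) isCompact_Icc.measure_lt_top).ne
    have hn0 : 0 ≤ (n : ℝ) * h := by positivity
    have h1 : a ≤ a + n * h := by linarith
    have h2 : a + n * h ≤ a + (n + 1 : ℕ) * h := by push_cast; linarith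
    have hU : Set.Ico a (a + (n + 1 : ℕ) * h) =
        Set.Ico a (a + n * h) ∪ Set.Ico (a + n * h) (a + (n + 1 : ℕ) * h) :=
      (Set.Ico_union_Ico_eq_Ico h1 h2).symm
    have hd : Disjoint (Set.Ico a (a + n * h)) (Set.Ico (a + n * h) (a + (n + 1 : ℕ) * h)) := by
      rw [Set.disjoint_left]
      intro x hx hx'
      exact absurd hx.2 (not_lt.2 hx'.1)
    have hmul : (n : ℝ) * h ≤ (n + 1 : ℕ) * h := by linarith
    have ih' := ih fun x hx y hy hxy =>
      hosc x ⟨hx.1, hx.2.trans h2⟩ y ⟨hy.1, hy.2.trans h2⟩ hxy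
    have hlast : |∫ x in Set.Ico (a + n * h) (a + (n + 1 : ℕ) * h), f x ∂μ -
        f (a + n * h) * μ.real (Set.Ico (a + n * h) (a + (n + 1 : ℕ) * h))|
        ≤ ε * μ.real (Set.Ico (a + n * h) (a + (n + 1 : ℕ) * h)) := by
      have hc : f (a + n * h) * μ.real (Set.Ico (a + n * h) (a + (n + 1 : ℕ) * h)) =
          ∫ _ in Set.Ico (a + n * h) (a + (n + 1 : ℕ) * h), f (a + n * h) ∂μ := by
        rw [setIntegral_const, smul_eq_mul, mul_comm]
      rw [hc, ← integral_sub (hint _ _) (integrableOn_const (hfin _ _)), ← Real.norm_eq_abs]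
      refine norm_setIntegral_le_of_norm_le_const (lt_top_iff_ne_top.2 (hfin _ _)) fun x hx => ?_
      rw [Real.norm_eq_abs]
      refine hosc x ⟨h1.trans hx.1, hx.2.le⟩ _ ⟨h1, h2⟩ ?_
      rw [abs_of_nonneg (by linarith [hx.1])]
      have := hx.2
      push_cast at this
      linarith
    rw [Finset.sum_range_succ, hU, setIntegral_union hd measurableSet_Ico (hint _ _) (hint _ _),
      measureReal_union hd measurableSet_Ico (hfin _ _) (hfin _ _), mul_add]
    refine le_trans ?_ (add_le_add ih' hlast)
    refine le_trans (le_of_eq ?_) (abs_add_le _ _)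
    congr 1
    ring

/-- Convergence of the masses of half-open intervals implies convergence of the integrals of
continuous functions over them. -/
theorem tendsto_setIntegral_Ico {μ : ℕ → Measure ℝ} {ν : Measure ℝ}
    (hμfin : ∀ N, IsLocallyFiniteMeasure (μ N)) [IsLocallyFiniteMeasure ν] {a b : ℝ}
    (hab : a < b)
    (hconv : ∀ c d, a ≤ c → c < d →
      Tendsto (fun N => (μ N).real (Set.Ico c d)) atTop (𝓝 (ν.real (Set.Ico c d))))
    {f : ℝ → ℝ} (hf : Continuous f) :
    Tendsto (fun N => ∫ x in Set.Ico a b, f x ∂(μ N)) atTop (𝓝 (∫ x in Set.Ico a b, f x ∂ν)) := by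
  rw [Metric.tendsto_atTop']
  intro ε hε
  set V := ν.real (Set.Ico a b) with hV
  have hV0 : 0 ≤ V := measureReal_nonneg
  obtain ⟨η, hη, hηε⟩ : ∃ η : ℝ, 0 < η ∧ η * (V + 1) + (η + η * V) < ε := by
    refine ⟨ε / (2 * (2 * V + 2)), by positivity, ?_⟩
    have : ε / (2 * (2 * V + 2)) * (2 * V + 2) = ε / 2 := by field_simp
    nlinarith
  have huc := isCompact_Icc.uniformContinuousOn_of_continuous (hf.continuousOn (s := Set.Icc a b))
  rw [Metric.uniformContinuousOn_iff] at huc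
  obtain ⟨ρ, hρ, hosc⟩ := huc η hη
  obtain ⟨n, hn⟩ := exists_nat_gt ((b - a) / ρ)
  have hn0 : (0 : ℝ) < n := lt_of_le_of_lt (div_nonneg (by linarith) hρ.le) hn
  set h := (b - a) / n with hh
  have hhpos : 0 < h := div_pos (by linarith) hn0
  have hhρ : h < ρ := by
    rw [hh, div_lt_iff₀ hn0]
    rw [div_lt_iff₀ hρ] at hn
    linarith
  have hb : a + n * h = b := by rw [hh]; field_simp; ring
  have hosc' : ∀ x ∈ Set.Icc a (a + n * h), ∀ y ∈ Set.Icc a (a + n * h),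
      |x - y| ≤ h → |f x - f y| ≤ η := by
    rw [hb]
    intro x hx y hy hxy
    exact (hosc x hx y hy (lt_of_le_of_lt hxy hhρ)).le
  have hsum : Tendsto (fun N => ∑ i ∈ Finset.range n,
      f (a + i * h) * (μ N).real (Set.Ico (a + i * h) (a + (i + 1 : ℕ) * h))) atTop
      (𝓝 (∑ i ∈ Finset.range n,
        f (a + i * h) * ν.real (Set.Ico (a + i * h) (a + (i + 1 : ℕ) * h)))) := by
    refine tendsto_finsetSum _ fun i _ => (hconv _ _ ?_ ?_).const_mul _
    · have : 0 ≤ (i : ℝ) * h := by positivity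
      linarith
    · push_cast
      linarith
  have e1 := (Metric.tendsto_atTop'.1 hsum) η hη
  have e2 := (Metric.tendsto_atTop'.1 (hconv a b le_rfl hab)) 1 one_pos
  obtain ⟨N1, h1⟩ := e1
  obtain ⟨N2, h2⟩ := e2
  refine ⟨max N1 N2, fun N hN => ?_⟩
  have k1 := h1 N (lt_of_le_of_lt (le_max_left _ _) hN)
  have k2 := h2 N (lt_of_le_of_lt (le_max_right _ _) hN)
  have A1 := abs_setIntegral_Ico_sub_sum_le (μ := ν) hf hhpos.le n hosc'
  have := hμfin N
  have A2 := abs_setIntegral_Ico_sub_sum_le (μ := μ N) hf hhpos.le n hosc'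
  rw [hb] at A1 A2
  rw [Real.dist_eq] at k1 k2 ⊢
  rw [abs_lt] at k1 k2 ⊢
  rw [abs_le] at A1 A2
  have : η * (μ N).real (Set.Ico a b) ≤ η * (V + 1) :=
    mul_le_mul_of_nonneg_left (by linarith [k2.2]) hη.le
  constructor <;> linarith [k1.1, k1.2, A1.1, A1.2, A2.1, A2.2]

/-- Integrals of uniformly bounded functions converging locally uniformly on `]0, +∞[`, against
probability measures converging there to a probability measure `ν` carried by `]0, +∞[`. No mass
can escape from a compact interval carrying almost all of `ν`, so the uniform bound `C` disposes of
what lies outside it, in particular near `0`, where the convergence of `φ` may fail. -/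
theorem tendsto_integral_of_tendstoUniformlyOn {μ : ℕ → Measure ℝ} {ν : Measure ℝ}
    (hμ : ∀ N, IsFiniteMeasure (μ N)) (hμ1 : ∀ᶠ N in atTop, (μ N).real Set.univ = 1)
    [IsProbabilityMeasure ν] (hν : ν (Set.Ioi 0) = 1)
    (hconv : ∀ c d, 0 < c → c < d →
      Tendsto (fun N => (μ N).real (Set.Ico c d)) atTop (𝓝 (ν.real (Set.Ico c d))))
    {φ : ℕ → ℝ → ℝ} {Φ : ℝ → ℝ} {C : ℝ} (hφm : ∀ N, Measurable (φ N)) (hΦ : Continuous Φ)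
    (hΦC : ∀ s, |Φ s| ≤ C) (hφC : ∀ᶠ N in atTop, ∀ s, |φ N s| ≤ C)
    (hunif : ∀ a b, 0 < a → a < b → TendstoUniformlyOn φ Φ atTop (Set.Icc a b)) :
    Tendsto (fun N => ∫ s, φ N s ∂(μ N)) atTop (𝓝 (∫ s, Φ s ∂ν)) := by
  rw [Metric.tendsto_nhds]
  intro ε hε
  have hC0 : 0 ≤ C := (abs_nonneg _).trans (hΦC 0)
  obtain ⟨η, hη, hηε⟩ : ∃ η : ℝ, 0 < η ∧ η + η + C * (2 * η) + C * η < ε := by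
    refine ⟨ε / (2 * (3 * C + 2)), by positivity, ?_⟩
    have : ε / (2 * (3 * C + 2)) * (3 * C + 2) = ε / 2 := by field_simp
    nlinarith
  -- an interval away from `0` and `+∞` carrying almost all of `ν`
  obtain ⟨a, b, ha, hab, hJ⟩ : ∃ a b : ℝ, 0 < a ∧ a < b ∧ 1 - η < ν.real (Set.Ico a b) := by
    have hmono : Monotone fun n : ℕ => Set.Ico (1 / ((n : ℝ) + 2)) ((n : ℝ) + 2) := by
      intro m n hmn
      have : (m : ℝ) ≤ n := by exact_mod_cast hmn
      refine Set.Ico_subset_Ico ?_ (by linarith)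
      exact one_div_le_one_div_of_le (by positivity) (by linarith)
    have hU : ⋃ n : ℕ, Set.Ico (1 / ((n : ℝ) + 2)) ((n : ℝ) + 2) = Set.Ioi 0 := by
      ext x
      simp only [Set.mem_iUnion, Set.mem_Ico, Set.mem_Ioi]
      constructor
      · rintro ⟨n, h1, -⟩
        exact lt_of_lt_of_le (by positivity) h1
      · intro hx
        obtain ⟨n, hn⟩ := exists_nat_gt (max x (1 / x))
        refine ⟨n, ?_, by linarith [le_max_left x (1 / x)]⟩
        rw [div_le_iff₀ (by positivity)]
        have h1 : 1 / x < n := lt_of_le_of_lt (le_max_right _ _) hn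
        rw [div_lt_iff₀ hx] at h1
        nlinarith
    have ht := tendsto_measure_iUnion_atTop (μ := ν) hmono
    rw [hU, hν] at ht
    have ht' := (ENNReal.tendsto_toReal ENNReal.one_ne_top).comp ht
    obtain ⟨n, hn⟩ := (ht'.eventually_const_lt
      (show 1 - η < (1 : ENNReal).toReal by simpa using hη)).exists
    refine ⟨1 / ((n : ℝ) + 2), (n : ℝ) + 2, by positivity, ?_, hn⟩
    have hn0 : (0 : ℝ) ≤ n := Nat.cast_nonneg n
    rw [div_lt_iff₀ (by positivity)]
    nlinarith
  have hu := Metric.tendstoUniformlyOn_iff.1 (hunif a b ha hab) η hη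
  have hI := (tendsto_setIntegral_Ico (μ := μ) (ν := ν) (fun N => inferInstance) hab
    (fun c d hc hcd => hconv c d (ha.trans_le hc) hcd) hΦ)
  have hm := (hconv a b ha hab).eventually (Metric.ball_mem_nhds _ hη)
  filter_upwards [hu, (Metric.tendsto_nhds.1 hI) η hη, hm, hμ1, hφC] with N h1 h2 h3 h4 h5
  have := hμ N
  have hbd : ∀ {ξ : Measure ℝ} [IsFiniteMeasure ξ] {g : ℝ → ℝ}, Measurable g →
      (∀ s, |g s| ≤ C) → ξ.real Set.univ = 1 →
      Integrable g ξ ∧ |∫ s, g s ∂ξ - ∫ s in Set.Ico a b, g s ∂ξ|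
        ≤ C * (1 - ξ.real (Set.Ico a b)) := by
    intro ξ _ g hg hgC h1
    have hint : Integrable g ξ :=
      (integrable_const C).mono' hg.aestronglyMeasurable (Eventually.of_forall hgC)
    refine ⟨hint, ?_⟩
    rw [← integral_add_compl (measurableSet_Ico (a := a) (b := b)) hint, add_sub_cancel_left,
      ← h1, ← measureReal_compl measurableSet_Ico, ← Real.norm_eq_abs]
    exact norm_setIntegral_le_of_norm_le_const (measure_lt_top _ _) fun s _ => hgC s
  obtain ⟨i1, B1⟩ := hbd (ξ := ν) hΦ.measurable hΦC (by simp)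
  obtain ⟨i2, B2⟩ := hbd (ξ := μ N) (hφm N) h5 h4
  obtain ⟨i3, -⟩ := hbd (ξ := μ N) hΦ.measurable hΦC h4
  have hJle : (μ N).real (Set.Ico a b) ≤ 1 := h4 ▸ measureReal_mono (Set.subset_univ _)
  have B3 : |∫ s in Set.Ico a b, φ N s ∂(μ N) - ∫ s in Set.Ico a b, Φ s ∂(μ N)| ≤ η := by
    rw [← integral_sub i2.integrableOn i3.integrableOn, ← Real.norm_eq_abs]
    refine (norm_setIntegral_le_of_norm_le_const (C := η) (measure_lt_top _ _)
      fun s hs => ?_).trans ?_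
    · have := h1 s ⟨hs.1, hs.2.le⟩
      rw [dist_comm, Real.dist_eq] at this
      exact this.le
    · exact mul_le_of_le_one_right hη.le hJle
  rw [Real.dist_eq, abs_lt] at h3
  rw [Real.dist_eq] at h2 ⊢
  rw [abs_lt] at h2 ⊢
  rw [abs_le] at B1 B2 B3
  have c1 : C * (1 - ν.real (Set.Ico a b)) ≤ C * η :=
    mul_le_mul_of_nonneg_left (by linarith) hC0
  have c2 : C * (1 - (μ N).real (Set.Ico a b)) ≤ C * (2 * η) :=
    mul_le_mul_of_nonneg_left (by linarith [h3.1]) hC0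
  constructor <;> linarith [h2.1, h2.2, B1.1, B1.2, B2.1, B2.2, B3.1, B3.2]

theorem tendstoUniformlyOn_of_tendsto_sub {φ : ℕ → ℝ → ℝ} {Φ : ℝ → ℝ} {s : Set ℝ}
    (h : Tendsto (fun q : ℕ × ℝ => φ q.1 q.2 - Φ q.2) (atTop ×ˢ 𝓟 s) (𝓝 0)) :
    TendstoUniformlyOn φ Φ atTop s := by
  rw [Metric.tendstoUniformlyOn_iff]
  intro ε hε
  have h1 := (Metric.tendsto_nhds.1 h) ε hε
  rw [eventually_prod_principal_iff] at h1
  filter_upwards [h1] with N hN x hx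
  have := hN x hx
  rwa [dist_zero_right, ← dist_eq_norm, dist_comm] at this

/-- Vague convergence follows from convergence of the masses of all half-open intervals. -/
theorem weakStarTendsto_of_Ico {μ : ℕ → Measure ℝ} {ν : Measure ℝ}
    (hμ : ∀ N, IsLocallyFiniteMeasure (μ N)) [IsLocallyFiniteMeasure ν]
    (hconv : ∀ c d, c < d →
      Tendsto (fun N => (μ N).real (Set.Ico c d)) atTop (𝓝 (ν.real (Set.Ico c d)))) :
    WeakStarTendsto μ ν := by
  intro f hf hfc
  obtain ⟨A, hA⟩ := hfc.isCompact.isBounded.subset_closedBall 0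
  have hzero : ∀ x, x ∉ Set.Ico (-(|A| + 1)) (|A| + 1) → f x = 0 := by
    intro x hx
    by_contra hne
    have h1 := hA (subset_tsupport f hne)
    rw [mem_closedBall_zero_iff, Real.norm_eq_abs] at h1
    have h2 := abs_le.1 (h1.trans (le_abs_self A))
    exact hx ⟨by linarith [h2.1], by linarith [h2.2]⟩
  have hab : -(|A| + 1) < |A| + 1 := by linarith [abs_nonneg A]
  have h := tendsto_setIntegral_Ico hμ hab (fun c d _ hcd => hconv c d hcd) hf
  simp only [setIntegral_eq_integral_of_forall_compl_eq_zero hzero] at h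
  exact h

/-! ### The exponential law -/

open ProbabilityTheory in
theorem expMeasure_Ioi_zero {δ : ℝ} (hδ : 0 < δ) : expMeasure δ (Set.Ioi 0) = 1 := by
  have := isProbabilityMeasure_expMeasure hδ
  have h := cdf_expMeasure_eq hδ 0
  rw [cdf_eq_real] at h
  have h2 := probReal_compl_eq_one_sub (μ := expMeasure δ) (measurableSet_Iic (a := (0 : ℝ)))
  rw [h, Set.compl_Iic] at h2
  simp only [le_refl, if_true, mul_zero, neg_zero, Real.exp_zero, sub_self, sub_zero] at h2
  rw [measureReal_def, ENNReal.toReal_eq_one_iff] at h2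
  exact h2

open ProbabilityTheory in
theorem expMeasure_real_Ico {δ : ℝ} (hδ : 0 < δ) {a b : ℝ} (ha : 0 ≤ a) (hab : a ≤ b) :
    (expMeasure δ).real (Set.Ico a b) = Real.exp (-(δ * a)) - Real.exp (-(δ * b)) := by
  have := isProbabilityMeasure_expMeasure hδ
  have hna : NullSingletonClass (expMeasure δ) := by
    unfold expMeasure gammaMeasure
    infer_instance
  rw [measureReal_congr Ico_ae_eq_Ioc, ← Set.Iic_sdiff_Iic,
    measureReal_sdiff (Set.Iic_subset_Iic.2 hab) measurableSet_Iic, ← cdf_eq_real, ← cdf_eq_real,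
    cdf_expMeasure_eq hδ, cdf_expMeasure_eq hδ, if_pos ha, if_pos (ha.trans hab)]
  ring

open ProbabilityTheory in
theorem integral_expMeasure {δ : ℝ} (hδ : 0 < δ) (g : ℝ → ℝ) :
    ∫ s, g s ∂(expMeasure δ) = ∫ s in Set.Ioi 0, δ * Real.exp (-(δ * s)) * g s := by
  have h : expMeasure δ = volume.withDensity (exponentialPDF δ) := rfl
  have hm : Measurable (exponentialPDF δ) := (measurable_exponentialPDFReal δ).ennreal_ofReal
  rw [h, integral_withDensity_eq_integral_toReal_smul hm
    (Eventually.of_forall fun _ => ENNReal.ofReal_lt_top),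
    ← setIntegral_eq_integral_of_forall_compl_eq_zero (s := Set.Ici 0),
    integral_Ici_eq_integral_Ioi]
  · refine setIntegral_congr_fun measurableSet_Ioi fun s hs => ?_
    simp only [smul_eq_mul]
    rw [exponentialPDF_of_nonneg (le_of_lt hs), ENNReal.toReal_ofReal (by positivity)]
  · intro s hs
    rw [exponentialPDF_of_neg (by simpa using hs)]
    simp

/-- The tail function `u ↦ P(S ≥ u)` of the exponential law of rate `δ`, for all real `u`. -/
noncomputable def expTail (δ u : ℝ) : ℝ := Real.exp (-(δ * max u 0))

theorem continuous_expTail (δ : ℝ) : Continuous (expTail δ) := by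
  unfold expTail
  fun_prop

theorem expTail_nonneg (δ u : ℝ) : 0 ≤ expTail δ u := (Real.exp_pos _).le

theorem expTail_le_one {δ : ℝ} (hδ : 0 < δ) (u : ℝ) : expTail δ u ≤ 1 := by
  unfold expTail
  rw [Real.exp_le_one_iff, neg_nonpos]
  exact mul_nonneg hδ.le (le_max_right _ _)

theorem setIntegral_Ioi_exp {δ : ℝ} (hδ : 0 < δ) (a : ℝ) :
    ∫ s in Set.Ioi a, δ * Real.exp (-(δ * s)) * Real.exp (-(δ * s)) =
      Real.exp (-(2 * δ * a)) / 2 := by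
  have h : ∀ s : ℝ, δ * Real.exp (-(δ * s)) * Real.exp (-(δ * s)) =
      δ * Real.exp (-(2 * δ) * s) := by
    intro s
    rw [mul_assoc, ← Real.exp_add]
    ring_nf
  simp_rw [h]
  rw [integral_const_mul, integral_exp_mul_Ioi (by linarith)]
  field_simp

theorem integral_exp_segment (δ a b : ℝ) :
    ∫ s in a..b, δ * Real.exp (-(δ * s)) = Real.exp (-(δ * a)) - Real.exp (-(δ * b)) := by
  rw [intervalIntegral.integral_eq_sub_of_hasDerivAt (f := fun s => -Real.exp (-(δ * s)))
    (fun _ _ => ProbabilityTheory.hasDerivAt_neg_exp_mul_exp)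
    (Continuous.intervalIntegrable (by fun_prop) _ _)]
  ring

/-- The integral is `P(S' - S ≥ a)` for independent exponential variables `S` and `S'`, so this
says that `S' - S` has the Laplace density `t ↦ δ / 2 * e ^ {-δ |t|}`. -/
theorem integral_expMeasure_expTail {δ : ℝ} (hδ : 0 < δ) (a : ℝ) :
    ∫ s, expTail δ (s + a) ∂(ProbabilityTheory.expMeasure δ) =
      1 / 2 - ∫ t in (0 : ℝ)..a, δ / 2 * Real.exp (-δ * |t|) := by
  rw [integral_expMeasure hδ]
  rcases le_total 0 a with ha | ha
  · have h1 : ∫ s in Set.Ioi 0, δ * Real.exp (-(δ * s)) * expTail δ (s + a) =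
        ∫ s in Set.Ioi 0, (δ * Real.exp (-(δ * s)) * Real.exp (-(δ * s))) *
          Real.exp (-(δ * a)) := by
      refine setIntegral_congr_fun measurableSet_Ioi fun s hs => ?_
      have hs' : 0 < s := hs
      simp only [expTail]
      rw [max_eq_left (by linarith), mul_add, neg_add, Real.exp_add]
      ring
    have h2 : ∫ t in (0 : ℝ)..a, δ / 2 * Real.exp (-δ * |t|) =
        ∫ t in (0 : ℝ)..a, 1 / 2 * (δ * Real.exp (-(δ * t))) := by
      refine intervalIntegral.integral_congr fun t ht => ?_
      rw [Set.uIcc_of_le ha] at ht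
      rw [abs_of_nonneg ht.1]
      ring_nf
    rw [h1, h2, integral_mul_const, setIntegral_Ioi_exp hδ,
      intervalIntegral.integral_const_mul (1 / 2 : ℝ),
      integral_exp_segment]
    simp
    ring
  · have hi : IntegrableOn (fun s => δ * Real.exp (-(δ * s)) * expTail δ (s + a)) (Set.Ioi 0) := by
      have hexp : IntegrableOn (fun s => δ * Real.exp (-(δ * s))) (Set.Ioi 0) := by
        have := (exp_neg_integrableOn_Ioi 0 hδ).const_mul δ
        simp only [neg_mul] at this
        exact this
      refine hexp.mono' ?_ (Eventually.of_forall fun s => ?_)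
      · exact (Continuous.mul (by fun_prop)
          ((continuous_expTail δ).comp (by fun_prop))).aestronglyMeasurable
      · rw [Real.norm_eq_abs, abs_of_nonneg (mul_nonneg (by positivity) (expTail_nonneg _ _))]
        exact mul_le_of_le_one_right (by positivity) (expTail_le_one hδ _)
    have h0 : (0 : ℝ) ≤ -a := by linarith
    have hsplit : Set.Ioi (0 : ℝ) = Set.Ioc 0 (-a) ∪ Set.Ioi (-a) :=
      (Set.Ioc_union_Ioi_eq_Ioi h0).symm
    rw [hsplit, setIntegral_union _ measurableSet_Ioi]
    rotate_left
    · exact hi.mono_set Set.Ioc_subset_Ioi_self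
    · exact hi.mono_set (Set.Ioi_subset_Ioi h0)
    · rw [Set.disjoint_left]
      intro x hx hx'
      exact absurd hx.2 (not_le.2 hx')
    have h1 : ∫ s in Set.Ioi (-a), δ * Real.exp (-(δ * s)) * expTail δ (s + a) =
        ∫ s in Set.Ioi (-a), (δ * Real.exp (-(δ * s)) * Real.exp (-(δ * s))) *
          Real.exp (-(δ * a)) := by
      refine setIntegral_congr_fun measurableSet_Ioi fun s hs => ?_
      have hs' : -a < s := hs
      simp only [expTail]
      rw [max_eq_left (by linarith), mul_add, neg_add, Real.exp_add]
      ring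
    have h2 : ∫ s in Set.Ioc 0 (-a), δ * Real.exp (-(δ * s)) * expTail δ (s + a) =
        ∫ s in Set.Ioc 0 (-a), δ * Real.exp (-(δ * s)) := by
      refine setIntegral_congr_fun measurableSet_Ioc fun s hs => ?_
      simp only [expTail]
      rw [max_eq_right (by linarith [hs.2])]
      simp
    have h3 : ∫ t in (0 : ℝ)..a, δ / 2 * Real.exp (-δ * |t|) =
        -∫ t in (0 : ℝ)..(-a), 1 / 2 * (δ * Real.exp (-(δ * t))) := by
      have h4 := intervalIntegral.integral_comp_neg (a := 0) (b := -a)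
        (fun t => δ / 2 * Real.exp (-δ * |t|))
      rw [neg_neg, neg_zero] at h4
      rw [intervalIntegral.integral_symm, ← h4, neg_inj]
      refine intervalIntegral.integral_congr fun t ht => ?_
      rw [Set.uIcc_of_le h0] at ht
      rw [abs_neg, abs_of_nonneg ht.1]
      ring_nf
    rw [h1, h2, h3, integral_mul_const, setIntegral_Ioi_exp hδ,
      ← intervalIntegral.integral_of_le h0, intervalIntegral.integral_const_mul (1 / 2 : ℝ),
      integral_exp_segment]
    have e1 : Real.exp (-(2 * δ * -a)) * Real.exp (-(δ * a)) = Real.exp (-(δ * -a)) := by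
      rw [← Real.exp_add]
      ring_nf
    simp only [mul_zero, neg_zero, Real.exp_zero]
    linear_combination e1 / 2

/-! ### The law of the distance to the endpoint -/

theorem integral_sum_smul_dirac {ι : Type*} (S : Finset ι) {a : ι → ℝ} (ha : ∀ i ∈ S, 0 ≤ a i)
    (p : ι → ℝ) (f : ℝ → ℝ) :
    ∫ t, f t ∂(∑ i ∈ S, ENNReal.ofReal (a i) • Measure.dirac (p i)) =
      ∑ i ∈ S, a i * f (p i) := by
  rw [integral_finsetSum_measure]
  · refine Finset.sum_congr rfl fun i hi => ?_
    rw [integral_smul_measure, integral_dirac, ENNReal.toReal_ofReal (ha i hi), smul_eq_mul]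
  · intro i _
    exact (integrable_dirac (by simp)).smul_measure ENNReal.ofReal_ne_top

theorem sum_smul_dirac_isFiniteMeasure {ι : Type*} (S : Finset ι) (a : ι → ℝ) (p : ι → ℝ) :
    IsFiniteMeasure (∑ i ∈ S, ENNReal.ofReal (a i) • Measure.dirac (p i)) := by
  have h : ∀ i, IsFiniteMeasure (ENNReal.ofReal (a i) • Measure.dirac (p i)) := fun i =>
    Measure.smul_finite _ ENNReal.ofReal_ne_top
  infer_instance

theorem sum_smul_dirac_real {ι : Type*} (S : Finset ι) {a : ι → ℝ} (ha : ∀ i ∈ S, 0 ≤ a i)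
    (p : ι → ℝ) {A : Set ℝ} (hA : MeasurableSet A) :
    (∑ i ∈ S, ENNReal.ofReal (a i) • Measure.dirac (p i)).real A =
      ∑ i ∈ S, a i * A.indicator 1 (p i) := by
  rw [← integral_indicator_one hA, integral_sum_smul_dirac S ha]

/-- The law of the distance to the endpoint `N` of a point of `F_N` drawn with probability
proportional to its weight, `W` being the total weight of `F_N`. -/
noncomputable def gapMeasure (F : WeightedFamily) (W : ℕ → ℝ) (N : ℕ) : Measure ℝ :=
  ∑ x ∈ F.sets N, ENNReal.ofReal (F.weight x / W N) • Measure.dirac (N - x)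

instance (F : WeightedFamily) (W : ℕ → ℝ) (N : ℕ) : IsFiniteMeasure (gapMeasure F W N) :=
  sum_smul_dirac_isFiniteMeasure _ _ _

instance (F : WeightedFamily) (ψ : ℕ → ℝ) (N : ℕ) :
    IsFiniteMeasure (pairCorrelationMeasure F ψ N) := by
  have h : ∀ x, IsFiniteMeasure (∑ y ∈ F.sets N,
      ENNReal.ofReal (F.weight x * F.weight y) • Measure.dirac (ψ N * (y - x))) := fun x =>
    sum_smul_dirac_isFiniteMeasure _ _ _
  unfold pairCorrelationMeasure
  infer_instance

/-- The rescaled pair correlation measure in terms of the gaps `s = N - y` and `s' = N - x`: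
since `y - x = s' - s`, the point `ψ N * (y - x)` lies in `[a, b[` exactly when `s'` lies in
`[s + a / ψ N, s + b / ψ N[`. -/
theorem pairCorrelationMeasure_real_Ico (F : WeightedFamily) {ψ W : ℕ → ℝ} {N : ℕ}
    (hψ : 0 < ψ N) (hW : 0 < W N) {a b : ℝ} (hab : a ≤ b) :
    (ENNReal.ofReal (1 / (W N ^ 2 / ψ N)) • pairCorrelationMeasure F ψ N).real (Set.Ico a b) =
      ∫ s, ψ N * ((gapMeasure F W N).real (Set.Ici (s + a / ψ N)) -
        (gapMeasure F W N).real (Set.Ici (s + b / ψ N))) ∂(gapMeasure F W N) := by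
  set f : ℝ → ℝ := (Set.Ico a b).indicator 1 with hf
  have hint : ∀ x y : ℝ, Integrable f
      (ENNReal.ofReal (F.weight x * F.weight y) • Measure.dirac (ψ N * (y - x))) := fun x y =>
    (integrable_dirac (by simp)).smul_measure ENNReal.ofReal_ne_top
  have hpos : ∀ x ∈ F.sets N, 0 ≤ F.weight x / W N := fun x hx =>
    (div_pos (F.weight_pos N x hx) hW).le
  have hIco : ∀ s : ℝ, (gapMeasure F W N).real (Set.Ici (s + a / ψ N)) -
      (gapMeasure F W N).real (Set.Ici (s + b / ψ N)) =
        ∑ x ∈ F.sets N, F.weight x / W N * f (ψ N * (N - x - s)) := by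
    intro s
    have hle : s + a / ψ N ≤ s + b / ψ N := by gcongr
    rw [← measureReal_sdiff (Set.Ici_subset_Ici.2 hle) measurableSet_Ici, Set.Ici_sdiff_Ici,
      gapMeasure, sum_smul_dirac_real _ hpos _ measurableSet_Ico]
    refine Finset.sum_congr rfl fun x _ => ?_
    congr 1
    have hiff : (N - x ∈ Set.Ico (s + a / ψ N) (s + b / ψ N)) ↔
        ψ N * (N - x - s) ∈ Set.Ico a b := by
      rw [Set.mem_Ico, Set.mem_Ico, ← le_sub_iff_add_le', ← sub_lt_iff_lt_add', div_le_iff₀' hψ,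
        lt_div_iff₀' hψ]
    by_cases h : ψ N * (N - x - s) ∈ Set.Ico a b
      <;> simp [hf, h, hiff.2, mt hiff.1]
  simp_rw [hIco]
  rw [← integral_indicator_one measurableSet_Ico, integral_smul_measure, pairCorrelationMeasure,
    integral_finsetSum_measure fun x _ => integrable_finsetSum_measure.2 fun y _ => hint x y,
    gapMeasure, integral_sum_smul_dirac _ hpos,
    ENNReal.toReal_ofReal (by positivity), smul_eq_mul]
  have hin : ∀ x ∈ F.sets N, ∫ t, f t ∂(∑ y ∈ F.sets N,
      ENNReal.ofReal (F.weight x * F.weight y) • Measure.dirac (ψ N * (y - x))) =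
        ∑ y ∈ F.sets N, F.weight x * F.weight y * f (ψ N * (y - x)) := fun x hx =>
    integral_sum_smul_dirac _
      (fun y hy => (mul_pos (F.weight_pos N x hx) (F.weight_pos N y hy)).le) _ _
  rw [Finset.sum_congr rfl hin]
  simp only [Finset.mul_sum]
  rw [Finset.sum_comm]
  refine Finset.sum_congr rfl fun x _ => Finset.sum_congr rfl fun y _ => ?_
  rw [show (N : ℝ) - y - (N - x) = x - y by ring]
  field_simp

theorem le_of_mem_truncationFamily {E : Set ℝ} (hE0 : E ⊆ Set.Ici 0) (hE : IsLocallyFiniteSet E)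
    {ω : ℝ → ℝ} (hω : IsWeightOn E ω) {N : ℕ} {x : ℝ}
    (hx : x ∈ (truncationFamily E hE0 hE ω hω).sets N) : x ≤ N := by
  simp only [truncationFamily, Set.Finite.mem_toFinset, Set.mem_ofPred_eq] at hx
  exact hx.2

theorem growthFunction_eq_sum {E : Set ℝ} (hE0 : E ⊆ Set.Ici 0) (hE : IsLocallyFiniteSet E)
    {ω : ℝ → ℝ} (hω : IsWeightOn E ω) {N : ℕ} {t : ℝ} (ht : t ≤ N) :
    growthFunction E ω t =
      ∑ x ∈ (truncationFamily E hE0 hE ω hω).sets N with x ≤ t, ω x := by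
  rw [growthFunction]
  refine finsum_mem_eq_finite_toFinset_sum _ (hE _ isCompact_Icc) |>.trans ?_
  refine Finset.sum_congr ?_ fun _ _ => rfl
  ext x
  simp only [truncationFamily, Set.Finite.mem_toFinset, Finset.mem_filter, Set.mem_inter_iff,
    Set.mem_Icc, Set.mem_ofPred_eq]
  exact ⟨fun h => ⟨⟨h.1, h.2.2.trans ht⟩, h.2.2⟩, fun h => ⟨h.1.1, hE0 h.1.1, h.2⟩⟩

theorem growthFunction_nonneg {E : Set ℝ} {ω : ℝ → ℝ} (hω : IsWeightOn E ω) (t : ℝ) :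
    0 ≤ growthFunction E ω t :=
  finsum_nonneg fun x => finsum_nonneg fun hx => (hω x hx.1).le

/-- The tail of the law of the gap. The truncation `max u 0` expresses that gaps are
nonnegative. -/
theorem gapMeasure_real_Ici {E : Set ℝ} (hE0 : E ⊆ Set.Ici 0) (hE : IsLocallyFiniteSet E)
    {ω : ℝ → ℝ} (hω : IsWeightOn E ω) (N : ℕ) (u : ℝ) :
    (gapMeasure (truncationFamily E hE0 hE ω hω) (fun n => growthFunction E ω n) N).real
      (Set.Ici u) = growthFunction E ω (N - max u 0) / growthFunction E ω N := by
  rw [gapMeasure, sum_smul_dirac_real _ _ _ measurableSet_Ici,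
    growthFunction_eq_sum hE0 hE hω (N := N) (t := N - max u 0)
      (by linarith [le_max_right u 0]), Finset.sum_filter, Finset.sum_div]
  · refine Finset.sum_congr rfl fun x hx => ?_
    have hxN := le_of_mem_truncationFamily hE0 hE hω hx
    have hiff : N - x ∈ Set.Ici u ↔ x ≤ N - max u 0 := by
      rw [Set.mem_Ici, le_sub_comm (b := (N : ℝ)) (c := max u 0), max_le_iff]
      exact ⟨fun h => ⟨h, by linarith⟩, fun h => h.1⟩
    by_cases h : x ≤ N - max u 0
    · rw [if_pos h, Set.indicator_of_mem (hiff.2 h)]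
      simp [truncationFamily]
    · rw [if_neg h, Set.indicator_of_notMem (mt hiff.1 h)]
      simp
  · intro x hx
    exact div_nonneg (WeightedFamily.weight_pos _ N x hx).le (growthFunction_nonneg hω _)

theorem gapMeasure_real_univ {E : Set ℝ} (hE0 : E ⊆ Set.Ici 0) (hE : IsLocallyFiniteSet E)
    {ω : ℝ → ℝ} (hω : IsWeightOn E ω) {N : ℕ} (hN : growthFunction E ω N ≠ 0) :
    (gapMeasure (truncationFamily E hE0 hE ω hω) (fun n => growthFunction E ω n) N).real
      Set.univ = 1 := by
  rw [gapMeasure, sum_smul_dirac_real _ _ _ MeasurableSet.univ]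
  · simp only [Set.indicator_univ, Pi.one_apply, mul_one]
    rw [← Finset.sum_div, div_eq_one_iff_eq hN, growthFunction_eq_sum hE0 hE hω le_rfl,
      Finset.filter_true_of_mem fun x hx => le_of_mem_truncationFamily hE0 hE hω hx]
    rfl
  · intro x hx
    exact div_nonneg (WeightedFamily.weight_pos _ N x hx).le (growthFunction_nonneg hω _)

/-! ### Growth functions equivalent to `c t ^ α e ^ {δ t}` -/

/-- The model growth function `t ↦ c t ^ α e ^ {δ t}`; only its values at `t > 0` matter. -/
noncomputable def modelGrowth (c α δ t : ℝ) : ℝ := c * t ^ α * Real.exp (δ * t)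

section ModelGrowth

variable {c α δ : ℝ}

theorem modelGrowth_pos (hc : 0 < c) {t : ℝ} (ht : 0 < t) : 0 < modelGrowth c α δ t := by
  unfold modelGrowth
  positivity

theorem modelGrowth_div (hc : 0 < c) {x y : ℝ} (hx : 0 < x) (hy : 0 < y) :
    modelGrowth c α δ x / modelGrowth c α δ y = (x / y) ^ α * Real.exp (δ * (x - y)) := by
  rw [modelGrowth, modelGrowth, Real.div_rpow hx.le hy.le, mul_sub, Real.exp_sub]
  have := Real.rpow_pos_of_pos hy α
  field_simp

theorem hasDerivAt_modelGrowth {t : ℝ} (ht : 0 < t) :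
    HasDerivAt (modelGrowth c α δ) (modelGrowth c α δ t * (δ + α / t)) t := by
  have h1 := (Real.hasDerivAt_rpow_const (p := α) (Or.inl ht.ne')).const_mul c
  have h2 : HasDerivAt (fun t => Real.exp (δ * t)) (Real.exp (δ * t) * (δ * 1)) t :=
    ((hasDerivAt_id t).const_mul δ).exp
  convert! h1.mul h2 using 1
  rw [modelGrowth, Real.rpow_sub_one ht.ne']
  ring

theorem exists_modelGrowth_sub_eq {x y : ℝ} (hx : 0 < x) (hxy : x ≤ y) :
    ∃ ξ ∈ Set.Icc x y, modelGrowth c α δ y - modelGrowth c α δ x =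
      (y - x) * (modelGrowth c α δ ξ * (δ + α / ξ)) := by
  rcases hxy.eq_or_lt with rfl | hlt
  · exact ⟨x, ⟨le_rfl, le_rfl⟩, by simp⟩
  · obtain ⟨ξ, hξ, h⟩ := exists_hasDerivAt_eq_slope (modelGrowth c α δ)
      (fun t => modelGrowth c α δ t * (δ + α / t)) hlt
      (fun t ht => (hasDerivAt_modelGrowth (hx.trans_le ht.1)).continuousAt.continuousWithinAt)
      (fun t ht => hasDerivAt_modelGrowth (hx.trans ht.1))
    refine ⟨ξ, ⟨hξ.1.le, hξ.2.le⟩, ?_⟩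
    rw [h, mul_div_cancel₀ _ (sub_pos.2 hlt).ne']

theorem eventually_slope_modelGrowth (hδ : 0 < δ) :
    ∀ᶠ T in atTop, 0 < T ∧ ∀ ξ, T ≤ ξ → 0 ≤ δ + α / ξ ∧ δ + α / ξ ≤ 2 * δ := by
  filter_upwards [eventually_gt_atTop 0, eventually_ge_atTop (|α| / δ)] with T hT0 hT
  refine ⟨hT0, fun ξ hξ => ?_⟩
  have hξ0 : 0 < ξ := hT0.trans_le hξ
  have h : |α / ξ| ≤ δ := by
    rw [abs_div, abs_of_pos hξ0, div_le_iff₀ hξ0]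
    have := (div_le_iff₀ hδ).1 (hT.trans hξ)
    linarith
  rw [abs_le] at h
  constructor <;> linarith [h.1, h.2]

theorem eventually_monotoneOn_modelGrowth (hc : 0 < c) (hδ : 0 < δ) :
    ∀ᶠ T in atTop, MonotoneOn (modelGrowth c α δ) (Set.Ici T) := by
  filter_upwards [eventually_slope_modelGrowth (α := α) hδ] with T hT x hx y hy hxy
  have hx0 : 0 < x := hT.1.trans_le hx
  obtain ⟨ξ, hξ, h⟩ := exists_modelGrowth_sub_eq (c := c) (α := α) (δ := δ) hx0 hxy
  have h1 := (hT.2 ξ (le_trans hx hξ.1)).1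
  have h2 := (modelGrowth_pos (α := α) (δ := δ) hc (hx0.trans_le hξ.1)).le
  have : 0 ≤ (y - x) * (modelGrowth c α δ ξ * (δ + α / ξ)) :=
    mul_nonneg (by linarith) (mul_nonneg h2 h1)
  linarith

theorem isBoundedUnder_exp_neg_mul (hδ : 0 < δ) {ι : Type*} {l : Filter ι} {u : ι → ℝ} {B : ℝ}
    (hu : ∀ᶠ q in l, |u q| ≤ B) :
    IsBoundedUnder (· ≤ ·) l (norm ∘ fun q => Real.exp (-(δ * u q))) := by
  refine ⟨Real.exp (δ * B), ?_⟩
  rw [eventually_map]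
  filter_upwards [hu] with q hq
  simp only [Function.comp_apply, Real.norm_eq_abs, Real.abs_exp]
  rw [Real.exp_le_exp]
  have := neg_le_of_abs_le hq
  nlinarith

/-- The gap to a far endpoint `n` is asymptotically exponential for the model growth. An arbitrary
filter is allowed so that the limit can be taken along `atTop ×ˢ 𝓟 s`, i.e. uniformly in a
parameter. -/
theorem tendsto_modelGrowth_ratio (hc : 0 < c) (hδ : 0 < δ) {ι : Type*} {l : Filter ι}
    {n u : ι → ℝ} (hn : Tendsto n l atTop) {B : ℝ} (hu : ∀ᶠ q in l, |u q| ≤ B) :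
    Tendsto (fun q => modelGrowth c α δ (n q - u q) / modelGrowth c α δ (n q) -
      Real.exp (-(δ * u q))) l (𝓝 0) := by
  have hz : Tendsto (fun q => u q / n q) l (𝓝 0) := by
    refine squeeze_zero_norm' ?_ ((tendsto_const_nhds (x := B)).div_atTop hn)
    filter_upwards [hu, hn.eventually_gt_atTop 0] with q hq hnq
    rw [norm_div, Real.norm_eq_abs, Real.norm_eq_abs, abs_of_pos hnq]
    gcongr
  have hp : Tendsto (fun q => (1 - u q / n q) ^ α) l (𝓝 1) := by
    have := (hz.const_sub 1).rpow_const (p := α) (Or.inl (by norm_num))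
    simpa using this
  have hb := isBoundedUnder_exp_neg_mul hδ hu
  have h0 : Tendsto (fun q => (1 - u q / n q) ^ α - 1) l (𝓝 0) := by
    simpa using hp.sub_const 1
  refine (h0.zero_mul_isBoundedUnder_le hb).congr' ?_
  filter_upwards [hn.eventually_gt_atTop 0, hn.eventually_gt_atTop B, hu] with q h1 h2 h3
  have h4 : 0 < n q - u q := by linarith [le_of_abs_le h3]
  rw [modelGrowth_div hc h4 h1]
  have : (n q - u q) / n q = 1 - u q / n q := by field_simp
  rw [this, show δ * (n q - u q - n q) = -(δ * u q) by ring]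
  ring

variable {G : ℝ → ℝ}

theorem tendsto_div_modelGrowth {κ : ℝ} (hc : 0 < c)
    (hκ : 0 ≤ κ) {r : ℝ → ℝ} (hr : r =o[atTop] fun t : ℝ => Real.exp (-κ * t))
    (hGr : ∀ᶠ t in atTop, G t = modelGrowth c α δ t * (1 + r t)) :
    Tendsto (fun t => G t / modelGrowth c α δ t) atTop (𝓝 1) := by
  have hr0 : Tendsto r atTop (𝓝 0) := by
    have hO : (fun t : ℝ => Real.exp (-κ * t)) =O[atTop] fun _ => (1 : ℝ) := by
      refine IsBigO.of_bound 1 ?_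
      filter_upwards [eventually_ge_atTop 0] with t ht
      rw [Real.norm_eq_abs, Real.abs_exp, norm_one, mul_one, Real.exp_le_one_iff]
      nlinarith
    exact (isLittleO_one_iff ℝ).1 (hr.trans_isBigO hO)
  have h := hr0.const_add 1
  rw [add_zero] at h
  refine h.congr' ?_
  filter_upwards [hGr, eventually_gt_atTop 0] with t h1 h2
  rw [h1, mul_div_cancel_left₀ _ (modelGrowth_pos hc h2).ne']

theorem tendsto_ratio_of_equiv (hc : 0 < c) (hδ : 0 < δ)
    (hG : Tendsto (fun t => G t / modelGrowth c α δ t) atTop (𝓝 1)) {ι : Type*} {l : Filter ι}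
    {n u : ι → ℝ} (hn : Tendsto n l atTop) {B : ℝ} (hu : ∀ᶠ q in l, |u q| ≤ B) :
    Tendsto (fun q => G (n q - u q) / G (n q) - Real.exp (-(δ * u q))) l (𝓝 0) := by
  have hnu : Tendsto (fun q => n q - u q) l atTop := by
    refine tendsto_atTop_mono' l ?_ (tendsto_atTop_add_const_right l (-B) hn)
    filter_upwards [hu] with q hq
    linarith [le_of_abs_le hq]
  have hH := tendsto_modelGrowth_ratio (α := α) hc hδ hn hu
  have hq : Tendsto (fun q => G (n q - u q) / modelGrowth c α δ (n q - u q) /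
      (G (n q) / modelGrowth c α δ (n q))) l (𝓝 1) := by
    have := (hG.comp hnu).div (hG.comp hn) one_ne_zero
    rw [div_one] at this
    exact this
  have hb := isBoundedUnder_exp_neg_mul hδ hu
  have hq0 := hq.sub_const 1
  rw [sub_self] at hq0
  have h := (hH.mul hq).add (hq0.zero_mul_isBoundedUnder_le hb)
  rw [zero_mul, add_zero] at h
  refine h.congr' ?_
  filter_upwards [hn.eventually_gt_atTop 0, hnu.eventually_gt_atTop 0] with q h1 h2
  have e1 := modelGrowth_pos (α := α) (δ := δ) hc h1
  have e2 := modelGrowth_pos (α := α) (δ := δ) hc h2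
  by_cases h3 : G (n q) = 0
  · simp [h3]
  · field_simp
    ring

theorem eventually_modelGrowth_le (hc : 0 < c)
    (hG : Tendsto (fun t => G t / modelGrowth c α δ t) atTop (𝓝 1)) :
    ∀ᶠ t in atTop, 0 < G t ∧ modelGrowth c α δ t ≤ 2 * G t := by
  filter_upwards [hG.eventually_const_lt (show (1 / 2 : ℝ) < 1 by norm_num),
    eventually_gt_atTop 0] with t h ht
  have hp := modelGrowth_pos (α := α) (δ := δ) hc ht
  rw [lt_div_iff₀ hp] at h
  constructor <;> linarith

/-- The error term of the growth function is negligible against `G N / ψ N`, uniformly on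
`[N / 3, N]`: there `e ^ {-κ t}` is at most `e ^ {-κ N / 3}`, which kills `ψ N`. -/
theorem eventually_mul_abs_sub_modelGrowth_le (hc : 0 < c) (hδ : 0 < δ)
    (hG : Tendsto (fun t => G t / modelGrowth c α δ t) atTop (𝓝 1)) {κ : ℝ}
    {r : ℝ → ℝ} (hr : r =o[atTop] fun t : ℝ => Real.exp (-κ * t)) (hκ : 0 ≤ κ)
    (hGr : ∀ᶠ t in atTop, G t = modelGrowth c α δ t * (1 + r t))
    {ψ : ℕ → ℝ} (hψ : ∀ N, 0 ≤ ψ N)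
    (hψκ : Tendsto (fun N : ℕ => ψ N * Real.exp (-(κ / 3) * N)) atTop (𝓝 0))
    {η : ℝ} (hη : 0 < η) :
    ∀ᶠ N : ℕ in atTop, ∀ t, (N : ℝ) / 3 ≤ t → t ≤ N →
      ψ N * |G t - modelGrowth c α δ t| ≤ η * G N := by
  have hN := tendsto_natCast_atTop_atTop (R := ℝ)
  have hN3 : Tendsto (fun N : ℕ => (N : ℝ) / 3) atTop atTop := hN.atTop_div_const (by norm_num)
  obtain ⟨T, hT1, hT2⟩ := ((eventually_monotoneOn_modelGrowth (α := α) hc hδ).and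
    (eventually_forall_ge_atTop.2
      ((hr.bound one_pos).and (hGr.and (eventually_gt_atTop 0))))).exists
  filter_upwards [hN3.eventually_ge_atTop T, hψκ.eventually_le_const (show 0 < η / 2 by positivity),
    hN.eventually (eventually_modelGrowth_le hc hG)] with N h1 h2 h3 t ht1 ht2
  obtain ⟨hb, he, h0⟩ := hT2 t (h1.trans ht1)
  have hH0 := (modelGrowth_pos (α := α) (δ := δ) hc h0).le
  have hH : modelGrowth c α δ t ≤ 2 * G N :=
    (hT1 (h1.trans ht1) (h1.trans (ht1.trans ht2)) ht2).trans h3.2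
  rw [one_mul, Real.norm_eq_abs, Real.norm_eq_abs, Real.abs_exp] at hb
  have hb' : |r t| ≤ Real.exp (-(κ / 3) * N) := by
    refine hb.trans (Real.exp_le_exp.2 ?_)
    nlinarith
  rw [he, show modelGrowth c α δ t * (1 + r t) - modelGrowth c α δ t =
    modelGrowth c α δ t * r t by ring, abs_mul, abs_of_nonneg hH0]
  calc ψ N * (modelGrowth c α δ t * |r t|)
      ≤ ψ N * (2 * G N * Real.exp (-(κ / 3) * N)) := by
        have := hψ N
        have := h3.1
        gcongr
    _ = 2 * G N * (ψ N * Real.exp (-(κ / 3) * N)) := by ring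
    _ ≤ 2 * G N * (η / 2) := by
        have := h3.1
        gcongr
    _ = η * G N := by ring

theorem tendsto_mul_exp_neg_of_polynomiallyGrowing {ψ : ℕ → ℝ} (h : AtMostPolynomiallyGrowing ψ)
    {b : ℝ} (hb : 0 < b) :
    Tendsto (fun N : ℕ => ψ N * Real.exp (-b * N)) atTop (𝓝 0) := by
  obtain ⟨γ, -, hγ⟩ := h
  have h1 := (tendsto_rpow_mul_exp_neg_mul_atTop_nhds_zero γ b hb).comp
    (tendsto_natCast_atTop_atTop (R := ℝ))
  have h2 := hγ.mul h1
  rw [mul_zero] at h2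
  refine h2.congr' ?_
  filter_upwards [eventually_gt_atTop 0] with N hN
  have : (0 : ℝ) < (N : ℝ) ^ γ := Real.rpow_pos_of_pos (by exact_mod_cast hN) _
  simp only [Function.comp_apply]
  field_simp

theorem tendsto_mul_half_ratio (hc : 0 < c) (hδ : 0 < δ)
    (hG : Tendsto (fun t => G t / modelGrowth c α δ t) atTop (𝓝 1))
    {ψ : ℕ → ℝ} (hψ : AtMostPolynomiallyGrowing ψ) :
    Tendsto (fun N : ℕ => ψ N * (G (N / 2) / G N)) atTop (𝓝 0) := by
  have hN := tendsto_natCast_atTop_atTop (R := ℝ)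
  have hN2 : Tendsto (fun N : ℕ => (N : ℝ) / 2) atTop atTop := hN.atTop_div_const (by norm_num)
  have h1 := (hG.comp hN2).div (hG.comp hN) one_ne_zero
  have h2 := ((tendsto_mul_exp_neg_of_polynomiallyGrowing hψ (b := δ / 2) (by positivity)).mul
    h1).const_mul ((1 / 2 : ℝ) ^ α)
  rw [zero_mul, mul_zero] at h2
  refine h2.congr' ?_
  filter_upwards [eventually_gt_atTop 0, hN.eventually (eventually_modelGrowth_le hc hG)]
    with N hN0 hGN
  have h0 : (0 : ℝ) < N := by exact_mod_cast hN0
  have hGN' := hGN.1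
  have e0 : (0 : ℝ) < N / 2 := by positivity
  have e1 := modelGrowth_pos (α := α) (δ := δ) hc h0
  have e2 := modelGrowth_pos (α := α) (δ := δ) hc e0
  have e3 := modelGrowth_div (α := α) (δ := δ) hc e0 h0
  rw [show (N : ℝ) / 2 / N = 1 / 2 by field_simp,
    show δ * ((N : ℝ) / 2 - N) = -(δ / 2) * N by ring, div_eq_iff e1.ne'] at e3
  simp only [Function.comp_apply, Pi.div_apply]
  have e4 : G (N / 2) / G N = G (N / 2) / modelGrowth c α δ (N / 2) / (G N / modelGrowth c α δ N) *
      (modelGrowth c α δ (N / 2) / modelGrowth c α δ N) := by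
    field_simp
  rw [e4, e3, mul_div_assoc, div_self e1.ne', ← e3]
  ring

end ModelGrowth

/-! ### Reduction to the limits of the gap correlations -/

theorem withDensity_ofReal_real_Ico {g : ℝ → ℝ} (hg : Continuous g) (hg0 : ∀ t, 0 ≤ g t)
    {a b : ℝ} (hab : a ≤ b) :
    (volume.withDensity fun t => ENNReal.ofReal (g t)).real (Set.Ico a b) =
      ∫ t in a..b, g t := by
  rw [measureReal_def, withDensity_apply _ measurableSet_Ico,
    ← integral_eq_lintegral_of_nonneg_ae (Eventually.of_forall hg0)
      hg.aestronglyMeasurable, integral_Ico_eq_integral_Ioo, ← integral_Ioc_eq_integral_Ioo,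
    intervalIntegral.integral_of_le hab]

section Gap

variable {E : Set ℝ} {ω : ℝ → ℝ} {c α δ : ℝ}

/-- `P(S ∈ [s + a / ψ N, s + b / ψ N[)`, multiplied by `ψ N`, where `S` is the distance to `N` of a
random point of `F_N`. -/
noncomputable def gapCorrelation (E : Set ℝ) (ω : ℝ → ℝ) (ψ : ℕ → ℝ) (a b : ℝ) (N : ℕ) (s : ℝ) :
    ℝ :=
  ψ N * (growthFunction E ω (N - max (s + a / ψ N) 0) / growthFunction E ω N -
    growthFunction E ω (N - max (s + b / ψ N) 0) / growthFunction E ω N)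

theorem growthFunction_mono (hE : IsLocallyFiniteSet E) (hω : IsWeightOn E ω) :
    Monotone (growthFunction E ω) := by
  intro x y hxy
  have hfin : ∀ t, (E ∩ Set.Icc 0 t).Finite := fun t => hE _ isCompact_Icc
  rw [growthFunction, growthFunction, finsum_mem_eq_finite_toFinset_sum _ (hfin x),
    finsum_mem_eq_finite_toFinset_sum _ (hfin y)]
  refine Finset.sum_le_sum_of_subset_of_nonneg ?_ fun z hz _ => ?_
  · rw [Set.Finite.toFinset_subset_toFinset]
    exact Set.inter_subset_inter_right _ (Set.Icc_subset_Icc_right hxy)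
  · exact (hω z ((Set.Finite.mem_toFinset _).1 hz).1).le

theorem measurable_gapCorrelation (hE : IsLocallyFiniteSet E) (hω : IsWeightOn E ω) (ψ : ℕ → ℝ)
    (a b : ℝ) (N : ℕ) : Measurable (gapCorrelation E ω ψ a b N) := by
  have hm := (growthFunction_mono hE hω).measurable
  unfold gapCorrelation
  fun_prop

/-- The rescaled pair correlation measure gives `[a, b[` the mass `E(φ N S)`, where `φ N` is
`gapCorrelation` and `S` the distance to `N` of a random point of `F_N`. As `S` is asymptotically
exponential, the limit of that mass follows from a bound on `φ` and its locally uniform limit. -/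
theorem hasPairCorrelationFunction_of_gapCorrelation (hE0 : E ⊆ Set.Ici 0)
    (hE : IsLocallyFiniteSet E) (hω : IsWeightOn E ω) (hc : 0 < c) (hδ : 0 < δ)
    (hG : Tendsto (fun t => growthFunction E ω t / modelGrowth c α δ t) atTop (𝓝 1))
    {ψ : ℕ → ℝ} (hψ : ∀ N, 1 ≤ ψ N) {g : ℝ → ℝ} (hg : Continuous g) (hg0 : ∀ t, 0 ≤ g t)
    {Φ : ℝ → ℝ → ℝ → ℝ} (hΦ : ∀ a b, Continuous (Φ a b))
    (hΦg : ∀ a b, a < b → ∫ s, Φ a b s ∂(ProbabilityTheory.expMeasure δ) = ∫ t in a..b, g t)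
    (hbound : ∀ a b, a < b → ∃ C, (∀ s, |Φ a b s| ≤ C) ∧
      ∀ᶠ N in atTop, ∀ s, |gapCorrelation E ω ψ a b N s| ≤ C)
    (hunif : ∀ a b, a < b → ∀ u v, 0 < u → u < v →
      Tendsto (fun q : ℕ × ℝ => gapCorrelation E ω ψ a b q.1 q.2 - Φ a b q.2)
        (atTop ×ˢ 𝓟 (Set.Icc u v)) (𝓝 0)) :
    HasPairCorrelationFunction (truncationFamily E hE0 hE ω hω) ψ
      (renormalisingFunction E ω ψ) g := by
  have hN := tendsto_natCast_atTop_atTop (R := ℝ)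
  have hψ0 : ∀ N, 0 < ψ N := fun N => one_pos.trans_le (hψ N)
  have hpos : ∀ᶠ N : ℕ in atTop, 0 < growthFunction E ω N :=
    (hN.eventually (eventually_modelGrowth_le hc hG)).mono fun _ h => h.1
  have := ProbabilityTheory.isProbabilityMeasure_expMeasure hδ
  refine ⟨hg0, hg.locallyIntegrable, ?_⟩
  have := IsLocallyFiniteMeasure.withDensity_ofReal (μ := volume) hg
  refine weakStarTendsto_of_Ico (fun N => ?_) fun a b hab => ?_
  · have := Measure.smul_finite (pairCorrelationMeasure (truncationFamily E hE0 hE ω hω) ψ N)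
      (ENNReal.ofReal_ne_top (r := 1 / renormalisingFunction E ω ψ N))
    infer_instance
  rw [withDensity_ofReal_real_Ico hg hg0 hab.le, ← hΦg a b hab]
  obtain ⟨C, hC1, hC2⟩ := hbound a b hab
  have key := tendsto_integral_of_tendstoUniformlyOn
    (μ := gapMeasure (truncationFamily E hE0 hE ω hω) fun n => growthFunction E ω n)
    (ν := ProbabilityTheory.expMeasure δ) (φ := gapCorrelation E ω ψ a b) (Φ := Φ a b) (C := C)
    (fun N => inferInstance) (hpos.mono fun N h => gapMeasure_real_univ hE0 hE hω h.ne')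
    (expMeasure_Ioi_zero hδ) ?_ (measurable_gapCorrelation hE hω ψ a b) (hΦ a b) hC1 hC2
    (fun u v hu huv => tendstoUniformlyOn_of_tendsto_sub (hunif a b hab u v hu huv))
  · refine key.congr' ?_
    filter_upwards [hpos] with N h
    rw [renormalisingFunction, pairCorrelationMeasure_real_Ico (W := fun n => growthFunction E ω n)
      _ (hψ0 N) h hab.le]
    simp only [gapMeasure_real_Ici, gapCorrelation]
  · intro u v hu huv
    rw [expMeasure_real_Ico hδ hu.le huv.le]
    have h1 : ∀ w : ℝ, 0 < w → Tendsto (fun N : ℕ => growthFunction E ω (N - max w 0) /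
        growthFunction E ω N) atTop (𝓝 (Real.exp (-(δ * w)))) := by
      intro w hw
      have h := tendsto_ratio_of_equiv hc hδ hG hN (u := fun _ => w) (B := |w|)
        (Eventually.of_forall fun _ => le_rfl)
      rw [max_eq_left hw.le]
      simpa using h.add_const (Real.exp (-(δ * w)))
    refine ((h1 u hu).sub (h1 v (hu.trans huv))).congr fun N => ?_
    rw [← Set.Ici_sdiff_Ici, measureReal_sdiff (Set.Ici_subset_Ici.2 huv.le) measurableSet_Ici,
      gapMeasure_real_Ici, gapMeasure_real_Ici]

end Gap

/-! ### Limits of the gap correlations -/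

section Limits

variable {E : Set ℝ} {ω : ℝ → ℝ} {c α δ : ℝ} {ψ : ℕ → ℝ}

theorem abs_gapCorrelation_le_one (hE : IsLocallyFiniteSet E) (hω : IsWeightOn E ω)
    (hψ : ∀ N, ψ N = 1) (a b : ℝ) (N : ℕ) (s : ℝ) : |gapCorrelation E ω ψ a b N s| ≤ 1 := by
  have h : ∀ w : ℝ, 0 ≤ growthFunction E ω (N - max w 0) / growthFunction E ω N ∧
      growthFunction E ω (N - max w 0) / growthFunction E ω N ≤ 1 := fun w =>
    ⟨div_nonneg (growthFunction_nonneg hω _) (growthFunction_nonneg hω _),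
      div_le_one_of_le₀ (growthFunction_mono hE hω (by linarith [le_max_right w 0]))
        (growthFunction_nonneg hω _)⟩
  rw [gapCorrelation, hψ, one_mul, abs_le]
  have h1 := h (s + a / 1)
  have h2 := h (s + b / 1)
  constructor <;> linarith [h1.1, h1.2, h2.1, h2.2]

/-- For the scaling `1`, `P(S ∈ [s + a, s + b[)` converges, locally uniformly in `s`, to its value
for an exponential variable `S`. -/
theorem tendsto_gapCorrelation_of_eq_one (hc : 0 < c) (hδ : 0 < δ)
    (hG : Tendsto (fun t => growthFunction E ω t / modelGrowth c α δ t) atTop (𝓝 1))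
    (hψ : ∀ N, ψ N = 1) (a b u v : ℝ) :
    Tendsto (fun q : ℕ × ℝ => gapCorrelation E ω ψ a b q.1 q.2 -
      (expTail δ (q.2 + a) - expTail δ (q.2 + b))) (atTop ×ˢ 𝓟 (Set.Icc u v)) (𝓝 0) := by
  have hn : Tendsto (fun q : ℕ × ℝ => (q.1 : ℝ)) (atTop ×ˢ 𝓟 (Set.Icc u v)) atTop :=
    tendsto_natCast_atTop_atTop.comp tendsto_fst
  have hs : ∀ᶠ q : ℕ × ℝ in atTop ×ˢ 𝓟 (Set.Icc u v), q.2 ∈ Set.Icc u v :=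
    tendsto_snd.eventually (mem_principal_self _)
  have h : ∀ w : ℝ, Tendsto (fun q : ℕ × ℝ => growthFunction E ω (q.1 - max (q.2 + w) 0) /
      growthFunction E ω q.1 - expTail δ (q.2 + w)) (atTop ×ˢ 𝓟 (Set.Icc u v)) (𝓝 0) := by
    intro w
    refine tendsto_ratio_of_equiv hc hδ hG hn (B := |v| + |w|) (hs.mono fun q hq => ?_)
    rw [abs_of_nonneg (le_max_right _ _), max_le_iff]
    refine ⟨?_, by positivity⟩
    linarith [hq.2, le_abs_self v, le_abs_self w]
  have h2 := (h a).sub (h b)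
  rw [sub_zero] at h2
  refine h2.congr fun q => ?_
  rw [gapCorrelation, hψ, one_mul, div_one, div_one]
  ring

/-- A bound uniform in `s`, for scalings that may be unbounded. Let `t₂ ≤ t₁` be `N - s - b / ψ N`
and `N - s - a / ψ N`, truncated at `N`. If `t₂ ≥ N / 3`, the mean value theorem for the model
bounds the mass of `]t₂, t₁]`. Otherwise `t₁ ≤ N / 2` for large `N`, and the whole mass of
`[0, N / 2]` is exponentially small against that of `[0, N]`, which beats the polynomial growth of
`ψ`. -/
theorem eventually_abs_gapCorrelation_le (hE : IsLocallyFiniteSet E) (hω : IsWeightOn E ω)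
    (hc : 0 < c) (hδ : 0 < δ)
    (hG : Tendsto (fun t => growthFunction E ω t / modelGrowth c α δ t) atTop (𝓝 1))
    (hψ : ∀ N, 1 ≤ ψ N) (hψpoly : AtMostPolynomiallyGrowing ψ)
    (herr : ∀ η, 0 < η → ∀ᶠ N : ℕ in atTop, ∀ t, (N : ℝ) / 3 ≤ t → t ≤ N →
      ψ N * |growthFunction E ω t - modelGrowth c α δ t| ≤ η * growthFunction E ω N)
    {a b : ℝ} (hab : a < b) :
    ∀ᶠ N in atTop, ∀ s, |gapCorrelation E ω ψ a b N s| ≤ (b - a) * (4 * δ) + 2 := by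
  have hN := tendsto_natCast_atTop_atTop (R := ℝ)
  have hN3 : Tendsto (fun N : ℕ => (N : ℝ) / 3) atTop atTop := hN.atTop_div_const (by norm_num)
  obtain ⟨T, ⟨hT0, hT1⟩, hT2⟩ := ((eventually_slope_modelGrowth (α := α) hδ).and
    (eventually_monotoneOn_modelGrowth (c := c) (α := α) hc hδ)).exists
  filter_upwards [herr 1 one_pos, hN3.eventually_ge_atTop T,
    hN.eventually (eventually_modelGrowth_le hc hG), hN.eventually_ge_atTop (6 * (b - a)),
    (tendsto_mul_half_ratio hc hδ hG hψpoly).eventually_le_const one_pos] with N h1 h2 h3 h4 h5 s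
  have hψN : 0 < ψ N := one_pos.trans_le (hψ N)
  have hGN := h3.1
  set t₁ := (N : ℝ) - max (s + a / ψ N) 0 with ht₁
  set t₂ := (N : ℝ) - max (s + b / ψ N) 0 with ht₂
  have hle : a / ψ N ≤ b / ψ N := by gcongr
  have h21 : t₂ ≤ t₁ := sub_le_sub_left (max_le_max (by linarith) le_rfl) _
  have h1N : t₁ ≤ N := by linarith [le_max_right (s + a / ψ N) 0]
  have hgap : t₁ - t₂ ≤ (b - a) / ψ N := by
    have : max (s + b / ψ N) 0 ≤ max (s + a / ψ N) 0 + (b - a) / ψ N := by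
      rw [max_le_iff, sub_div]
      constructor <;> linarith [le_max_left (s + a / ψ N) 0, le_max_right (s + a / ψ N) 0]
    linarith
  have hmono := growthFunction_mono hE hω
  have hval : gapCorrelation E ω ψ a b N s =
      ψ N * (growthFunction E ω t₁ - growthFunction E ω t₂) / growthFunction E ω N := by
    rw [gapCorrelation, ← sub_div, mul_div_assoc]
  have hnn : 0 ≤ ψ N * (growthFunction E ω t₁ - growthFunction E ω t₂) :=
    mul_nonneg hψN.le (sub_nonneg.2 (hmono h21))
  rw [hval, abs_of_nonneg (div_nonneg hnn hGN.le)]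
  rcases le_or_gt ((N : ℝ) / 3) t₂ with ht | ht
  · rw [div_le_iff₀ hGN]
    have e1 := h1 t₁ (ht.trans h21) h1N
    have e2 := h1 t₂ ht (h21.trans h1N)
    obtain ⟨ξ, hξ, hξe⟩ := exists_modelGrowth_sub_eq (c := c) (α := α) (δ := δ)
      (hT0.trans_le (h2.trans ht)) h21
    have hTξ : T ≤ ξ := (h2.trans ht).trans hξ.1
    have hHξ : modelGrowth c α δ ξ ≤ 2 * growthFunction E ω N :=
      (hT2 hTξ (hTξ.trans (hξ.2.trans h1N)) (hξ.2.trans h1N)).trans h3.2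
    have hHξ0 := (modelGrowth_pos (α := α) (δ := δ) hc (hT0.trans_le hTξ)).le
    have e3 : ψ N * (modelGrowth c α δ t₁ - modelGrowth c α δ t₂) ≤
        (b - a) * (4 * δ) * growthFunction E ω N := by
      have hgap' : ψ N * (t₁ - t₂) ≤ b - a := by
        rw [le_div_iff₀ hψN] at hgap
        linarith
      calc ψ N * (modelGrowth c α δ t₁ - modelGrowth c α δ t₂)
          = (ψ N * (t₁ - t₂)) * (modelGrowth c α δ ξ * (δ + α / ξ)) := by rw [hξe]; ring
        _ ≤ (b - a) * (2 * growthFunction E ω N * (2 * δ)) := by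
          refine mul_le_mul hgap' (mul_le_mul hHξ (hT1 ξ hTξ).2 (hT1 ξ hTξ).1 (by positivity))
            (mul_nonneg hHξ0 (hT1 ξ hTξ).1) (by linarith)
        _ = (b - a) * (4 * δ) * growthFunction E ω N := by ring
    have e1' : ψ N * (growthFunction E ω t₁ - modelGrowth c α δ t₁) ≤ growthFunction E ω N := by
      rw [one_mul] at e1
      exact (mul_le_mul_of_nonneg_left (le_abs_self _) hψN.le).trans e1
    have e2' : ψ N * (modelGrowth c α δ t₂ - growthFunction E ω t₂) ≤ growthFunction E ω N := by
      rw [one_mul, abs_sub_comm] at e2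
      exact (mul_le_mul_of_nonneg_left (le_abs_self _) hψN.le).trans e2
    linarith
  · have hba : (b - a) / ψ N ≤ b - a := div_le_self (by linarith) (hψ N)
    have e1 : growthFunction E ω t₁ ≤ growthFunction E ω (N / 2) := hmono (by linarith)
    have e2 := growthFunction_nonneg hω t₂
    have e3 : ψ N * (growthFunction E ω t₁ - growthFunction E ω t₂) ≤
        ψ N * growthFunction E ω (N / 2) :=
      mul_le_mul_of_nonneg_left (by linarith) hψN.le
    have e4 : ψ N * (growthFunction E ω t₁ - growthFunction E ω t₂) / growthFunction E ω N ≤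
        ψ N * growthFunction E ω (N / 2) / growthFunction E ω N := by gcongr
    rw [mul_div_assoc _ (growthFunction E ω (N / 2))] at e4
    have : 0 ≤ (b - a) * (4 * δ) := mul_nonneg (by linarith) (by linarith)
    linarith

/-- For scalings tending to infinity, `gapCorrelation` converges, locally uniformly in `s > 0`, to
`b - a` times the density `δ e ^ {-δ s}` of the exponential law: a local limit theorem at
the scale `1 / ψ N`. -/
theorem tendsto_gapCorrelation_of_tendsto_atTop (hc : 0 < c) (hδ : 0 < δ)
    (hG : Tendsto (fun t => growthFunction E ω t / modelGrowth c α δ t) atTop (𝓝 1))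
    (hψ : ∀ N, 1 ≤ ψ N) (hψtop : Tendsto ψ atTop atTop)
    (herr : ∀ η, 0 < η → ∀ᶠ N : ℕ in atTop, ∀ t, (N : ℝ) / 3 ≤ t → t ≤ N →
      ψ N * |growthFunction E ω t - modelGrowth c α δ t| ≤ η * growthFunction E ω N)
    {a b u v : ℝ} (hab : a < b) (hu : 0 < u) :
    Tendsto (fun q : ℕ × ℝ => gapCorrelation E ω ψ a b q.1 q.2 -
      (b - a) * δ * expTail δ q.2) (atTop ×ˢ 𝓟 (Set.Icc u v)) (𝓝 0) := by
  set l : Filter (ℕ × ℝ) := atTop ×ˢ 𝓟 (Set.Icc u v) with hl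
  have hN := tendsto_natCast_atTop_atTop (R := ℝ)
  have hfst : Tendsto (fun q : ℕ × ℝ => q.1) l atTop := tendsto_fst
  have hn : Tendsto (fun q : ℕ × ℝ => (q.1 : ℝ)) l atTop := hN.comp hfst
  have hs : ∀ᶠ q : ℕ × ℝ in l, q.2 ∈ Set.Icc u v := tendsto_snd.eventually (mem_principal_self _)
  have hψl : Tendsto (fun q : ℕ × ℝ => ψ q.1) l atTop := hψtop.comp hfst
  have hdiv : ∀ w : ℝ, Tendsto (fun q : ℕ × ℝ => w / ψ q.1) l (𝓝 0) := fun w =>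
    tendsto_const_nhds.div_atTop hψl
  have hin : ∀ w : ℝ, ∀ᶠ q : ℕ × ℝ in l, 0 < q.2 + w / ψ q.1 ∧
      (q.1 : ℝ) / 3 ≤ q.1 - (q.2 + w / ψ q.1) ∧ q.1 - (q.2 + w / ψ q.1) ≤ q.1 := by
    intro w
    filter_upwards [hs, (hdiv w).eventually_const_lt (show -u < 0 by linarith),
      (hdiv w).eventually_lt_const one_pos, hn.eventually_ge_atTop (2 * (v + 1))] with q h1 h2 h3 h4
    refine ⟨by linarith [h1.1], by linarith [h1.2], by linarith [h1.1]⟩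
  have hGpos : ∀ᶠ q : ℕ × ℝ in l, 0 < growthFunction E ω q.1 :=
    (hn.eventually (eventually_modelGrowth_le hc hG)).mono fun _ h => h.1
  -- replacing the growth function by the model at either end of the interval costs `o(1)`,
  -- even after multiplication by `ψ N`
  have hE : ∀ w : ℝ, Tendsto (fun q : ℕ × ℝ => ψ q.1 *
      (growthFunction E ω (q.1 - (q.2 + w / ψ q.1)) -
        modelGrowth c α δ (q.1 - (q.2 + w / ψ q.1))) / growthFunction E ω q.1) l (𝓝 0) := by
    intro w
    rw [Metric.tendsto_nhds]
    intro ε hε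
    filter_upwards [hfst.eventually (herr (ε / 2) (by positivity)), hin w, hGpos] with q h1 h2 h3
    have := h1 _ h2.2.1 h2.2.2
    rw [dist_zero_right, Real.norm_eq_abs, abs_div, abs_of_pos h3, div_lt_iff₀ h3, abs_mul,
      abs_of_pos (one_pos.trans_le (hψ q.1))]
    nlinarith
  have hex : ∀ q : ℕ × ℝ, ∃ ξ : ℝ, 0 < (q.1 : ℝ) - (q.2 + b / ψ q.1) →
      ξ ∈ Set.Icc ((q.1 : ℝ) - (q.2 + b / ψ q.1)) (q.1 - (q.2 + a / ψ q.1)) ∧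
      modelGrowth c α δ (q.1 - (q.2 + a / ψ q.1)) - modelGrowth c α δ (q.1 - (q.2 + b / ψ q.1)) =
        (b - a) / ψ q.1 * (modelGrowth c α δ ξ * (δ + α / ξ)) := by
    intro q
    by_cases h : 0 < (q.1 : ℝ) - (q.2 + b / ψ q.1)
    · have := one_pos.trans_le (hψ q.1)
      have hle : a / ψ q.1 ≤ b / ψ q.1 := by gcongr
      obtain ⟨ξ, h1, h2⟩ := exists_modelGrowth_sub_eq (c := c) (α := α) (δ := δ) h
        (show (q.1 : ℝ) - (q.2 + b / ψ q.1) ≤ q.1 - (q.2 + a / ψ q.1) by linarith)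
      refine ⟨ξ, fun _ => ⟨h1, ?_⟩⟩
      rw [h2]
      ring
    · exact ⟨0, fun h' => absurd h' h⟩
  choose ξ hξ using hex
  have hξ' : ∀ᶠ q in l, ξ q ∈ Set.Icc ((q.1 : ℝ) - (q.2 + b / ψ q.1)) (q.1 - (q.2 + a / ψ q.1)) ∧
      modelGrowth c α δ (q.1 - (q.2 + a / ψ q.1)) - modelGrowth c α δ (q.1 - (q.2 + b / ψ q.1)) =
        (b - a) / ψ q.1 * (modelGrowth c α δ (ξ q) * (δ + α / ξ q)) := by
    filter_upwards [hin b, hn.eventually_gt_atTop 0] with q h1 h2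
    exact hξ q (by linarith [h1.2.1])
  have hξtop : Tendsto ξ l atTop := by
    refine tendsto_atTop_mono' l ?_ (hn.atTop_div_const (show (0 : ℝ) < 3 by norm_num))
    filter_upwards [hξ', hin b] with q h1 h2
    exact h2.2.1.trans h1.1.1
  -- the intermediate point lies at distance `o(1)` from `N - s`, as `ψ` is unbounded
  have he : Tendsto (fun q : ℕ × ℝ => q.1 - ξ q - q.2) l (𝓝 0) := by
    refine tendsto_of_tendsto_of_tendsto_of_le_of_le' (hdiv a) (hdiv b) ?_ ?_
    · filter_upwards [hξ'] with q h
      linarith [h.1.2]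
    · filter_upwards [hξ'] with q h
      linarith [h.1.1]
  have hX : Tendsto (fun q : ℕ × ℝ => modelGrowth c α δ (ξ q) / modelGrowth c α δ q.1 -
      Real.exp (-(δ * (q.1 - ξ q)))) l (𝓝 0) := by
    have h := tendsto_modelGrowth_ratio (α := α) hc hδ hn (u := fun q : ℕ × ℝ => q.1 - ξ q)
      (B := v + 1) ?_
    · simpa using h
    · filter_upwards [he.eventually_lt_const one_pos,
        he.eventually_const_lt (show -u < 0 by linarith), hs] with q h1 h2 h3
      rw [abs_of_nonneg (by linarith [h3.1])]
      linarith [h3.2]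
  have hbdd : IsBoundedUnder (· ≤ ·) l (norm ∘ fun q : ℕ × ℝ => expTail δ q.2) := by
    refine ⟨1, ?_⟩
    rw [eventually_map]
    refine Eventually.of_forall fun q => ?_
    rw [Function.comp_apply, Real.norm_eq_abs, abs_of_nonneg (expTail_nonneg _ _)]
    exact expTail_le_one hδ _
  have hexp : Tendsto (fun q : ℕ × ℝ => (Real.exp (-(δ * (q.1 - ξ q - q.2))) - 1) *
      expTail δ q.2) l (𝓝 0) := by
    refine Tendsto.zero_mul_isBoundedUnder_le ?_ hbdd
    have h := ((Real.continuous_exp.tendsto _).comp (he.const_mul δ).neg).sub_const 1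
    simpa using h
  have hX' : Tendsto (fun q : ℕ × ℝ => modelGrowth c α δ (ξ q) / modelGrowth c α δ q.1 -
      expTail δ q.2) l (𝓝 0) := by
    have h := hX.add hexp
    rw [add_zero] at h
    refine h.congr' ?_
    filter_upwards [hs] with q hq
    have : Real.exp (-(δ * (q.1 - ξ q))) =
        Real.exp (-(δ * (q.1 - ξ q - q.2))) * expTail δ q.2 := by
      rw [expTail, max_eq_left (hu.le.trans hq.1), ← Real.exp_add]
      ring_nf
    rw [this]
    ring
  have hY : Tendsto (fun q : ℕ × ℝ => modelGrowth c α δ q.1 / growthFunction E ω q.1) l (𝓝 1) := by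
    have h := (hG.comp hn).inv₀ one_ne_zero
    rw [inv_one] at h
    exact h.congr fun q => inv_div _ _
  have hZ : Tendsto (fun q : ℕ × ℝ => δ + α / ξ q) l (𝓝 δ) := by
    simpa using (tendsto_const_nhds.div_atTop hξtop).const_add δ
  have hYZ := hY.mul hZ
  rw [one_mul] at hYZ
  have hYZ0 := hYZ.sub_const δ
  rw [sub_self] at hYZ0
  have hmain := ((hX'.mul hYZ).add (hYZ0.zero_mul_isBoundedUnder_le hbdd)).const_mul (b - a)
  have htot := (hmain.add (hE a)).sub (hE b)
  simp only [zero_mul, add_zero, mul_zero, sub_zero] at htot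
  refine htot.congr' ?_
  filter_upwards [hin a, hin b, hξ', hGpos, hn.eventually_gt_atTop 0] with q h1 h2 h3 h4 h5
  have hψq : 0 < ψ q.1 := one_pos.trans_le (hψ q.1)
  have hHq := modelGrowth_pos (α := α) (δ := δ) hc h5
  rw [gapCorrelation, max_eq_left h1.1.le, max_eq_left h2.1.le]
  have e1 : (b - a) * (modelGrowth c α δ (ξ q) * (δ + α / ξ q)) =
      ψ q.1 * (modelGrowth c α δ (q.1 - (q.2 + a / ψ q.1)) -
        modelGrowth c α δ (q.1 - (q.2 + b / ψ q.1))) := by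
    rw [h3.2]
    field_simp
  have e2 : (b - a) * (modelGrowth c α δ (ξ q) / modelGrowth c α δ q.1 *
      (modelGrowth c α δ q.1 / growthFunction E ω q.1 * (δ + α / ξ q))) =
      ψ q.1 * (modelGrowth c α δ (q.1 - (q.2 + a / ψ q.1)) -
        modelGrowth c α δ (q.1 - (q.2 + b / ψ q.1))) / growthFunction E ω q.1 := by
    rw [← e1]
    generalize δ + α / ξ q = z
    field_simp
  linear_combination e2

end Limits

/-! ### The pair correlation functions -/

theorem theorem1p1 (E : Set ℝ) (hE0 : E ⊆ Set.Ici 0) (hE : IsLocallyFiniteSet E)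
    (ω : ℝ → ℝ) (hω : IsWeightOn E ω)
    (α c δ κ : ℝ) (hc : 0 < c) (hδ : 0 < δ) (hκ : 0 ≤ κ)
    (hgrowth : ∃ r : ℝ → ℝ, r =o[atTop] (fun t : ℝ => Real.exp (-κ * t)) ∧
      ∀ᶠ t : ℝ in atTop,
        growthFunction E ω t = c * t ^ α * Real.exp (δ * t) * (1 + r t))
    (ψ : ℕ → ℝ) (hψ : ∀ N, 1 ≤ ψ N) (hψpoly : AtMostPolynomiallyGrowing ψ) :
    ((∀ N, ψ N = 1) →
      HasPairCorrelationFunction (truncationFamily E hE0 hE ω hω) ψ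
        (renormalisingFunction E ω ψ) (fun t => δ / 2 * Real.exp (-δ * |t|))) ∧
    (Tendsto ψ atTop atTop → 0 < κ →
      HasPoissonianBehaviour (truncationFamily E hE0 hE ω hω) ψ
        (renormalisingFunction E ω ψ) (δ / 2)) := by
  obtain ⟨r, hr, hGr⟩ := hgrowth
  have hG : Tendsto (fun t => growthFunction E ω t / modelGrowth c α δ t) atTop (𝓝 1) :=
    tendsto_div_modelGrowth hc hκ hr hGr
  have := ProbabilityTheory.isProbabilityMeasure_expMeasure hδ
  have hcont : ∀ a : ℝ, Continuous fun s => expTail δ (s + a) := fun a =>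
    (continuous_expTail δ).comp (by fun_prop)
  have hint : ∀ a : ℝ,
      Integrable (fun s => expTail δ (s + a)) (ProbabilityTheory.expMeasure δ) := fun a =>
    (integrable_const (1 : ℝ)).mono' (hcont a).aestronglyMeasurable
      (Eventually.of_forall fun s => by
        rw [Real.norm_eq_abs, abs_of_nonneg (expTail_nonneg _ _)]
        exact expTail_le_one hδ _)
  constructor
  · intro hψ1
    have hg : Continuous fun t : ℝ => δ / 2 * Real.exp (-δ * |t|) := by fun_prop
    refine hasPairCorrelationFunction_of_gapCorrelation hE0 hE hω hc hδ hG hψ hg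
      (fun t => by positivity) (Φ := fun a b s => expTail δ (s + a) - expTail δ (s + b))
      (fun a b => (hcont a).sub (hcont b)) (fun a b _ => ?_)
      (fun a b _ => ⟨1, fun s => ?_, Eventually.of_forall fun N s =>
        abs_gapCorrelation_le_one hE hω hψ1 a b N s⟩)
      (fun a b _ u v _ _ => tendsto_gapCorrelation_of_eq_one hc hδ hG hψ1 a b u v)
    · have h := intervalIntegral.integral_interval_sub_left (a := 0)
        (hg.intervalIntegrable (μ := volume) 0 b) (hg.intervalIntegrable 0 a)
      rw [integral_sub (hint a) (hint b), integral_expMeasure_expTail hδ,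
        integral_expMeasure_expTail hδ]
      linear_combination h
    · rw [abs_le]
      constructor <;> linarith [expTail_nonneg δ (s + a), expTail_nonneg δ (s + b),
        expTail_le_one hδ (s + a), expTail_le_one hδ (s + b)]
  · intro hψtop hκ0
    have herr := fun η hη => eventually_mul_abs_sub_modelGrowth_le hc hδ hG hr hκ hGr
      (fun N => zero_le_one.trans (hψ N))
      (tendsto_mul_exp_neg_of_polynomiallyGrowing hψpoly (b := κ / 3) (by positivity))
      (η := η) hη
    refine ⟨by positivity, hasPairCorrelationFunction_of_gapCorrelation hE0 hE hω hc hδ hG hψ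
      continuous_const (fun _ => by positivity)
      (Φ := fun a b s => (b - a) * δ * expTail δ s)
      (fun a b => (continuous_expTail δ).const_mul _) (fun a b _ => ?_)
      (fun a b hab => ⟨(b - a) * (4 * δ) + 2, fun s => ?_,
        eventually_abs_gapCorrelation_le hE hω hc hδ hG hψ hψpoly herr hab⟩)
      (fun a b hab u v hu _ =>
        tendsto_gapCorrelation_of_tendsto_atTop hc hδ hG hψ hψtop herr hab hu)⟩
    · have h := integral_expMeasure_expTail hδ 0
      simp only [add_zero, intervalIntegral.integral_same, sub_zero] at h
      rw [integral_const_mul, h, intervalIntegral.integral_const, smul_eq_mul]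
      ring
    · have h0 := expTail_nonneg δ s
      have h1 := expTail_le_one hδ s
      have h2 : 0 < (b - a) * δ := mul_pos (by linarith) hδ
      rw [abs_of_nonneg (by positivity)]
      nlinarith
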